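/- Let $\mathcal{A}=(Q,A,(M_a)_{a\in A},i,F)$ be a probabilistic automaton: $Q$ is a finite set of states, $A$ a finite alphabet, each $M_a\in[0,1]^{Q\times Q}$ is a matrix whose rows are probability distributions, $i\in Q$ and $F\subseteq Q$. For a word $w=a_1\cdots a_n\in A^*$ let $w(s,t)=(M_{a_1}\cdots M_{a_n})(s,t)$ (the identity matrix for the empty word). A \emph{limit-word} is a map $\mathbf{u}:Q^2\to\{0,1\}$ such that for every $s\in Q$ there is $t\in Q$ with $\mathbf{u}(s,t)=1$. The concatenation $\mathbf{u}\cdot\mathbf{v}$ is defined by $(\mathbf{u}\cdot\mathbf{v})(s,t)=1$ iff $\mathbf{u}(s,q)=1$ and $\mathbf{v}(q,t)=1$ for some $q\in Q$. If $\mathbf{u}\cdot\mathbf{u}=\mathbf{u}$, a state $t$ is $\mathbf{u}$-recurrent if $\mathbf{u}(t,t')=1$ implies $\mathbf{u}(t',t)=1$ for all $t'\in Q$, and the iteration $\mathbf{u}^\sharp$ is the limit-word with $\mathbf{u}^\sharp(s,t)=1$ iff $\mathbf{u}(s,t)=1$ and $t$ is $\mathbf{u}$-recurrent. The \emph{Markov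 monoid} $\mathcal{G}$ of $\mathcal{A}$ is the smallest set of limit-words that contains the identity limit-word $\mathbf{1}$ (with $\mathbf{1}(s,t)=1$ iff $s=t$) and, for each $a\in A$, the limit-word $\mathbf{a}$ with $\mathbf{a}(s,t)=1$ iff $M_a(s,t)>0$, and that is closed under concatenation and under iteration of its idempotent elements. A word $u$ is \emph{idempotent} if for all $s,t\in Q$, $u(s,t)>0$ iff $(uu)(s,t)>0$. A \emph{leak} from $r\in Q$ to $q\in Q$ is a sequence $(u_n)_{n\in\mathbb{N}}$ of idempotent words such that $u_n(s,t)$ converges to some $u(s,t)$ for all $s,t\in Q$, the state $r$ is recurrent in the Markov chain on $Q$ with transition probabilities $(u(s,t))_{s,t\in Q}$ (that is, $r$ is reachable from every state reachable from $r$), $u_n(r,q)>0$ for all $n$, and $r$ is not reachable from $q$ in this Markov chain. The automaton is \emph{leaktight} if it has no leak. \textbf{Theorem.} (1) (Consistency.) For every $\mathbf{u}\in\mathcal{G}$ there is a sequence $(u_n)_{n\in\mathbb{N}}$ of words in $A^*$ such that for all $s,t\in Q$ the sequence $(u_n(s,t))_{n\in\mathbb{N}}$ converges, and $\mathbf{u}(s,t)=1$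 if and only if $\lim_n u_n(s,t)>0$. (2) (Completeness.) If $\mathcal{A}$ is leaktight, then for every sequence $(u_n)_{n\in\mathbb{N}}$ of words in $A^*$ there is $\mathbf{u}\in\mathcal{G}$ such that for all $s,t\in Q$, $\limsup_n u_n(s,t)=0$ implies $\mathbf{u}(s,t)=0$. -/

import Mathlib

open Filter Topology

/-- A probabilistic automaton with state set `Q` and input alphabet `A`: every letter carries a
transition matrix whose rows are probability distributions over `Q`; there is one initial state
and a set of accepting states. -/
structure ProbAutomaton (Q A : Type*) [Fintype Q] [DecidableEq Q] where
  trans : A → Matrix Q Q ℝ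
  trans_stochastic : ∀ a, trans a ∈ Matrix.rowStochastic ℝ Q
  init : Q
  accept : Set Q

/-- A limit-word: a map from `Q × Q` to `{0, 1}`, written as a relation (`u.edge s t` means
that the value at `(s, t)` is `1`), such that every state has an outgoing edge. -/
@[ext]
structure LimitWord (Q : Type*) where
  edge : Q → Q → Prop
  exists_edge : ∀ s, ∃ t, edge s t

namespace LimitWord

variable {Q : Type*}

/-- The identity limit-word. -/
instance : One (LimitWord Q) where
  one := ⟨fun s t => s = t, fun s => ⟨s, rfl⟩⟩

/-- Concatenation of limit-words, i.e. the product of boolean matrices. -/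
instance : Mul (LimitWord Q) where
  mul u v := ⟨fun s t => ∃ q, u.edge s q ∧ v.edge q t, fun s => by
    obtain ⟨q, hq⟩ := u.exists_edge s
    obtain ⟨t, ht⟩ := v.exists_edge q
    exact ⟨t, q, hq, ht⟩⟩

/-- The state `s` is `u`-recurrent (used for idempotent `u`). -/
def Recurrent (u : LimitWord Q) (s : Q) : Prop :=
  ∀ t, u.edge s t → u.edge t s

/-- In an idempotent limit-word on a finite set of states, every state has an edge to a
recurrent state; so the iteration is again a limit-word. -/
theorem exists_edge_recurrent [Finite Q] (u : LimitWord Q) (hu : u * u = u) (s : Q) :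
    ∃ t, u.edge s t ∧ u.Recurrent t := by
  have htr : ∀ {a b c : Q}, u.edge a b → u.edge b c → u.edge a c := by
    intro a b c hab hbc
    have h : (u * u).edge a c := ⟨b, hab, hbc⟩
    rwa [hu] at h
  obtain ⟨t, hst, hmin⟩ := exists_minimalFor_of_wellFoundedLT (fun t => u.edge s t)
    (fun t => {x | u.edge t x}.ncard) (u.exists_edge s)
  have key : ∀ r, u.edge t r → {x | u.edge r x} = {x | u.edge t x} := by
    intro r hr
    have hsub : {x | u.edge r x} ⊆ {x | u.edge t x} := fun x hx => htr hr hx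
    exact Set.eq_of_subset_of_ncard_le hsub
      (hmin (htr hst hr) (Set.ncard_le_ncard hsub)) (Set.toFinite _)
  obtain ⟨r, hr⟩ := u.exists_edge t
  refine ⟨r, htr hst hr, fun x hx => ?_⟩
  have hx' : x ∈ {x | u.edge t x} := key r hr ▸ hx
  have : r ∈ {y | u.edge x y} := by rw [key x hx']; exact hr
  exact this

/-- The iteration `u♯` of an idempotent limit-word `u`: only the edges leading to `u`-recurrent
states are kept. -/
def iter [Finite Q] (u : LimitWord Q) (hu : u * u = u) : LimitWord Q where
  edge s t := u.edge s t ∧ u.Recurrent t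
  exists_edge := u.exists_edge_recurrent hu

end LimitWord

/-- Reachability (in any number of steps) in the Markov chain with transition probabilities
`P`. -/
def ChainReachable {Q : Type*} (P : Matrix Q Q ℝ) : Q → Q → Prop :=
  Relation.ReflTransGen fun s t => 0 < P s t

/-- The state `s` is recurrent in the finite Markov chain with transition probabilities `P`. -/
def ChainRecurrent {Q : Type*} (P : Matrix Q Q ℝ) (s : Q) : Prop :=
  ∀ t, ChainReachable P s t → ChainReachable P t s

namespace ProbAutomaton

variable {Q A : Type*} [Fintype Q] [DecidableEq Q] (𝒜 : ProbAutomaton Q A)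

/-- `𝒜.prob w s t` is the probability to go from `s` to `t` when reading the word `w`, that is,
the `(s, t)` entry of the product of the transition matrices of the letters of `w`. -/
def prob (w : List A) : Matrix Q Q ℝ :=
  (w.map 𝒜.trans).prod

/-- A word is idempotent if reading it once or twice gives the same positive entries. -/
def IdempotentWord (w : List A) : Prop :=
  ∀ s t, 0 < 𝒜.prob w s t ↔ 0 < 𝒜.prob (w ++ w) s t

/-- The sequence of words `w` is a leak from the state `r` to the state `q`. -/
def IsLeak (w : ℕ → List A) (r q : Q) : Prop :=
  (∀ n, 𝒜.IdempotentWord (w n)) ∧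
  ∃ P : Matrix Q Q ℝ,
    (∀ s t, Tendsto (fun n => 𝒜.prob (w n) s t) atTop (𝓝 (P s t))) ∧
    ChainRecurrent P r ∧
    (∀ n, 0 < 𝒜.prob (w n) r q) ∧
    ¬ ChainReachable P q r

/-- An automaton is leaktight if it has no leak. -/
def Leaktight : Prop :=
  ¬ ∃ (w : ℕ → List A) (r q : Q), 𝒜.IsLeak w r q

/-- The limit-word induced by a letter. -/
def letter (a : A) : LimitWord Q where
  edge s t := 0 < 𝒜.trans a s t
  exists_edge s := by
    have h := 𝒜.trans_stochastic a
    rw [Matrix.mem_rowStochastic_iff_sum] at h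
    have hs : (0 : ℝ) < ∑ t, 𝒜.trans a s t := by rw [h.2 s]; exact one_pos
    obtain ⟨t, -, ht⟩ := Finset.exists_lt_of_sum_lt (s := Finset.univ) (f := fun _ : Q => (0 : ℝ))
      (g := fun t => 𝒜.trans a s t) (by simpa using hs)
    exact ⟨t, ht⟩

/-- Membership in the Markov monoid: the smallest collection of limit-words that contains the
identity and the limit-words induced by letters and is closed under concatenation and under
iteration of idempotents. -/
inductive InMarkovMonoid : LimitWord Q → Prop
  | one : InMarkovMonoid 1
  | letter (a : A) : InMarkovMonoid (𝒜.letter a)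
  | mul {u v : LimitWord Q} : InMarkovMonoid u → InMarkovMonoid v → InMarkovMonoid (u * v)
  | iter {u : LimitWord Q} (hu : u * u = u) : InMarkovMonoid u → InMarkovMonoid (u.iter hu)

/-- The Markov monoid of the automaton. -/
def markovMonoid : Set (LimitWord Q) :=
  {u | 𝒜.InMarkovMonoid u}

/-- The sequence of words `w` reifies the limit-word `u`. -/
def Reifies (w : ℕ → List A) (u : LimitWord Q) : Prop :=
  ∀ s t, ∃ l : ℝ, Tendsto (fun n => 𝒜.prob (w n) s t) atTop (𝓝 l) ∧ (u.edge s t ↔ 0 < l)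

/-- A set of limit-words is consistent with `𝒜` if each of them is reified by some sequence of
input words. -/
def Consistent (G : Set (LimitWord Q)) : Prop :=
  ∀ u ∈ G, ∃ w : ℕ → List A, 𝒜.Reifies w u

/-- A set of limit-words is complete for `𝒜` if for every sequence of input words some
limit-word in the set vanishes wherever the sequence has limit superior zero. (The entries of
the sequence lie in `[0, 1]`, so the limit superior is a genuine one.) -/
def Complete (G : Set (LimitWord Q)) : Prop :=
  ∀ w : ℕ → List A, ∃ u ∈ G, ∀ s t,
    limsup (fun n => 𝒜.prob (w n) s t) atTop = 0 → ¬ u.edge s t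

end ProbAutomaton

/-! Consistency is an induction over the Markov monoid in which only iteration needs an argument. If
words converge to a stochastic matrix `P` with idempotent support `u`, then mass on non-recurrent
states decays geometrically under powers of `P`, while the entries kept by `u♯` stay bounded below.
So the powers of `P` accumulate at a matrix with support `u♯` (`exists_tendsto_pow`), and a diagonal
choice replaces powers of `P` by powers of words.

Completeness needs lower bounds independent of word length. Words are labelled by pairs `(v, u)`:
`v` is the exact support of the word, and `u` lies in the Markov monoid and is reified by some
sequence of words with support `v`. A variant of Simon's factorization forest theorem
(`exists_bound`) builds every word by a tree of bounded height `K`. Its nodes are binary products,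
or arbitrarily long products of factors with one idempotent label, at which `u` becomes `u♯`. A
binary node multiplies two lower bounds; a long node merely squares one (`sq_le_list_prod`),
provided every `v`-edge out of a `u`-recurrent state has a `u`-edge back. A missing edge back is a
leak (`Leaktight.edge_of_recurrent`). So with `p` a lower bound for the positive letter
probabilities, every `u`-edge of the label carries probability at least `p ^ 2 ^ K`; some label
occurs infinitely often along the given sequence, and its `u` is the required limit-word.

The height is bounded because an iteration that changes an idempotent strictly shrinks its two-sided
ideal (`IsIteration.idealRank_lt`), so ranks are eliminated from the top; where iteration changes
nothing, the induction is on the number of labels of cut points (`good_prod_of_gapsIn`). -/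

section Factorization

/-- The number of elements of the principal two-sided ideal generated by `x`. -/
noncomputable def idealRank {S : Type*} [Monoid S] (x : S) : ℕ :=
  {y : S | ∃ a b, y = a * x * b}.ncard

/-! ### Ideals and stability in finite monoids -/

section Rank

variable {S : Type*} [Monoid S] [Finite S]

theorem idealRank_pos (x : S) : 0 < idealRank x :=
  (Set.ncard_pos (Set.toFinite _)).2 ⟨x, 1, 1, by simp⟩

theorem idealRank_le_card (x : S) : idealRank x ≤ Nat.card S :=
  Set.ncard_le_card _

theorem idealRank_mul_mul_le (a x b : S) : idealRank (a * x * b) ≤ idealRank x := by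
  refine Set.ncard_le_ncard ?_ (Set.toFinite _)
  rintro y ⟨c, d, rfl⟩
  exact ⟨c * a, b * d, by simp only [mul_assoc]⟩

theorem idealRank_mul_le_left (x y : S) : idealRank (x * y) ≤ idealRank x := by
  simpa using idealRank_mul_mul_le 1 x y

theorem idealRank_mul_le_right (x y : S) : idealRank (x * y) ≤ idealRank y := by
  simpa using idealRank_mul_mul_le x y 1

theorem exists_eq_mul_mul_of_idealRank {a x b : S} (h : idealRank x ≤ idealRank (a * x * b)) :
    ∃ c d, x = c * (a * x * b) * d := by
  have hsub : {y : S | ∃ c d, y = c * (a * x * b) * d} ⊆ {y : S | ∃ c d, y = c * x * d} := by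
    rintro y ⟨c, d, rfl⟩
    exact ⟨c * a, b * d, by simp only [mul_assoc]⟩
  have heq := Set.eq_of_subset_of_ncard_le hsub h (Set.toFinite _)
  have hx : x ∈ {y : S | ∃ c d, y = c * x * d} := ⟨1, 1, by simp⟩
  rw [← heq] at hx
  exact hx

theorem exists_pow_idempotent (x : S) : ∃ n : ℕ, x ^ (n + 1) * x ^ (n + 1) = x ^ (n + 1) := by
  obtain ⟨n, m, hne, hnm⟩ := Finite.exists_ne_map_eq_of_infinite (fun n : ℕ => x ^ n)
  wlog hlt : n < m generalizing n m
  · exact this m n hne.symm hnm.symm (by omega)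
  obtain ⟨d, rfl⟩ : ∃ d, m = n + (d + 1) := ⟨m - n - 1, by omega⟩
  have hper : ∀ j i : ℕ, n ≤ i → x ^ (i + j * (d + 1)) = x ^ i := by
    intro j
    induction j with
    | zero => simp
    | succ j ih =>
      intro i hi
      obtain ⟨i', rfl⟩ := Nat.exists_eq_add_of_le hi
      have : n + i' + (j + 1) * (d + 1) = (n + (d + 1)) + (i' + j * (d + 1)) := by ring
      rw [this, pow_add, ← hnm, ← pow_add, ← add_assoc, ih _ hi]
  -- Any positive multiple of the period `d + 1` that is at least the preperiod `n` is an idempotent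
  -- exponent.
  refine ⟨(n + 1) * (d + 1) - 1, ?_⟩
  have h1 : (n + 1) * (d + 1) - 1 + 1 = (n + 1) * (d + 1) :=
    Nat.sub_add_cancel (Nat.mul_pos (by omega) (by omega))
  rw [h1, ← pow_add]
  exact hper (n + 1) _ (by nlinarith)

/-- Stability of finite monoids. Iterating `v = (c * p) * v * d` puts a power of `c * p` in front of
`v`; an idempotent such power fixes `v`, and its last factor `p` can be split off. -/
theorem exists_eq_mul_of_idealRank_left {p v : S} (h : idealRank v ≤ idealRank (p * v)) :
    ∃ a, v = a * (p * v) := by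
  obtain ⟨c, d, hcd⟩ := exists_eq_mul_mul_of_idealRank (a := p) (x := v) (b := 1) (by simpa using h)
  have hv : v = (c * p) * v * d := by simpa [mul_assoc] using hcd
  have hn : ∀ n : ℕ, v = (c * p) ^ n * v * d ^ n := by
    intro n
    induction n with
    | zero => simp
    | succ n ih =>
      calc v = (c * p) ^ n * v * d ^ n := ih
        _ = (c * p) ^ n * ((c * p) * v * d) * d ^ n := by rw [← hv]
        _ = (c * p) ^ (n + 1) * v * d ^ (n + 1) := by
          rw [pow_succ, pow_succ']; simp only [mul_assoc]
  obtain ⟨n, hidem⟩ := exists_pow_idempotent (c * p)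
  have hfix : (c * p) ^ (n + 1) * v = v := by
    rw [hn (n + 1), ← mul_assoc, ← mul_assoc, hidem]
  refine ⟨(c * p) ^ n * c, ?_⟩
  conv_lhs => rw [← hfix]
  rw [pow_succ]; simp only [mul_assoc]

theorem exists_eq_mul_of_idealRank_right {v s : S} (h : idealRank v ≤ idealRank (v * s)) :
    ∃ a, v = v * s * a := by
  obtain ⟨c, d, hcd⟩ := exists_eq_mul_mul_of_idealRank (a := 1) (x := v) (b := s) (by simpa using h)
  have hv : v = c * v * (s * d) := by simpa [mul_assoc] using hcd
  have hn : ∀ n : ℕ, v = c ^ n * v * (s * d) ^ n := by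
    intro n
    induction n with
    | zero => simp
    | succ n ih =>
      calc v = c ^ n * v * (s * d) ^ n := ih
        _ = c ^ n * (c * v * (s * d)) * (s * d) ^ n := by rw [← hv]
        _ = c ^ (n + 1) * v * (s * d) ^ (n + 1) := by
          rw [pow_succ, pow_succ']; simp only [mul_assoc]
  obtain ⟨n, hidem⟩ := exists_pow_idempotent (s * d)
  have hfix : v * (s * d) ^ (n + 1) = v := by
    rw [hn (n + 1), mul_assoc, mul_assoc, hidem, ← mul_assoc]
  refine ⟨d * (s * d) ^ n, ?_⟩
  conv_lhs => rw [← hfix]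
  rw [pow_succ']; simp only [mul_assoc]

/-- By stability `v = a * p` and `v' = q * b`, so `v * v'` collapses to `v` from the left and to
`v'` from the right. This makes all blocks between equally labelled gaps one and the same
idempotent. -/
theorem eq_mul_of_fixes {p q v v' : S} (hp : p * v = p) (hp' : p * v' = p)
    (hq : v * q = q) (hq' : v' * q = q) (hpv : idealRank v ≤ idealRank p)
    (hqv : idealRank v' ≤ idealRank q) : v * v' = v ∧ v * v' = v' := by
  obtain ⟨a, ha⟩ := exists_eq_mul_of_idealRank_left (p := p) (v := v) (by rwa [hp])
  obtain ⟨b, hb⟩ := exists_eq_mul_of_idealRank_right (v := v') (s := q) (by rwa [hq'])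
  rw [hp] at ha
  rw [hq'] at hb
  constructor
  · conv_lhs => rw [ha]
    rw [mul_assoc, hp', ← ha]
  · conv_lhs => rw [hb]
    rw [← mul_assoc, hq, ← hb]

end Rank

/-- The algebraic properties of an iteration operation on the idempotents of a monoid. -/
structure IsIteration {S : Type*} [Monoid S] (sharp : S → S) : Prop where
  idem : ∀ e, e * e = e → sharp e * sharp e = sharp e
  mul_left : ∀ e, e * e = e → e * sharp e = sharp e
  mul_right : ∀ e, e * e = e → sharp e * e = sharp e

/-- At equal rank, stability gives `e = a * sharp e`, and absorbing one more `sharp e` yields `sharp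
e = e`. -/
theorem IsIteration.idealRank_lt {S : Type*} [Monoid S] [Finite S] {sharp : S → S}
    (h : IsIteration sharp) {e : S} (he : e * e = e) (hne : sharp e ≠ e) :
    idealRank (sharp e) < idealRank e := by
  by_contra hcon
  obtain ⟨a, ha⟩ := exists_eq_mul_of_idealRank_left (p := sharp e) (v := e)
    (by rw [h.mul_right e he]; omega)
  rw [h.mul_right e he] at ha
  apply hne
  calc sharp e = e * sharp e := (h.mul_left e he).symm
    _ = a * sharp e * sharp e := by rw [← ha]
    _ = e := by rw [mul_assoc, h.idem e he, ← ha]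

/-- `Good k (x, m)` is meant to say that `m` has a factorization tree of height at most `k` whose
root is labelled by `x`; these are the closure properties of that notion. -/
structure IsTreeFiltration {S M : Type*} [Monoid S] [Monoid M] (sharp : S → S)
    (Good : ℕ → S × M → Prop) : Prop where
  one : Good 0 1
  succ : ∀ k z, Good k z → Good (k + 1) z
  mul : ∀ k z z', Good k z → Good k z' → Good (k + 1) (z * z')
  iter : ∀ k e (l : List (S × M)), e * e = e → l ≠ [] → (∀ z ∈ l, z.1 = e ∧ Good k z) →
    Good (k + 1) (sharp e, l.prod.2)

/-! ### Factorization trees of bounded height -/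

namespace IsTreeFiltration

variable {S M : Type*} [Monoid S] [Monoid M] {sharp : S → S} {Good : ℕ → S × M → Prop}

theorem mono (h : IsTreeFiltration sharp Good) {k k' : ℕ} (hk : k ≤ k') {z : S × M}
    (hz : Good k z) : Good k' z := by
  induction hk with
  | refl => exact hz
  | step _ ih => exact h.succ _ _ ih

theorem prod_fst_eq {e : S} (he : e * e = e) :
    ∀ l : List (S × M), l ≠ [] → (∀ z ∈ l, z.1 = e) → l.prod.1 = e
  | [], h, _ => absurd rfl h
  | [z], _, h => by simpa using h z (by simp)
  | z :: z' :: l, _, h => by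
    rw [List.prod_cons, Prod.fst_mul, h z (by simp),
      prod_fst_eq he (z' :: l) (by simp) fun y hy => h y (List.mem_cons_of_mem _ hy), he]

theorem idealRank_prod_le [Finite S] {n : ℕ} :
    ∀ l : List (S × M), l ≠ [] → (∀ z ∈ l, idealRank z.1 ≤ n) → idealRank l.prod.1 ≤ n
  | [], h, _ => absurd rfl h
  | z :: l, _, h => by
    rw [List.prod_cons, Prod.fst_mul]
    exact (idealRank_mul_le_left _ _).trans (h z (by simp))

/-- A run of trees of the same rank: the product still has this rank and iteration does not
change any idempotent that is the value of a part of the run. -/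
structure Run (sharp : S → S) (Good : ℕ → S × M → Prop) (k n : ℕ) (l : List (S × M)) : Prop where
  good : ∀ z ∈ l, Good k z ∧ idealRank z.1 = n
  stable : ∀ a b c, l = a ++ b ++ c → b ≠ [] → b.prod.1 * b.prod.1 = b.prod.1 →
    sharp b.prod.1 = b.prod.1

theorem Run.left {k n : ℕ} {a b : List (S × M)} (h : Run sharp Good k n (a ++ b)) :
    Run sharp Good k n a :=
  ⟨fun z hz => h.good z (by simp [hz]), fun x y z hxyz hy => h.stable x y (z ++ b)
    (by rw [hxyz]; simp) hy⟩

theorem Run.right {k n : ℕ} {a b : List (S × M)} (h : Run sharp Good k n (a ++ b)) :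
    Run sharp Good k n b :=
  ⟨fun z hz => h.good z (by simp [hz]), fun x y z hxyz hy => h.stable (a ++ x) y z
    (by rw [hxyz]; simp) hy⟩

theorem Run.idealRank_prod [Finite S] {k n : ℕ} {l : List (S × M)} (h : Run sharp Good k n l)
    (hl : l ≠ []) {p s : S} (hr : n ≤ idealRank (p * l.prod.1 * s)) : idealRank l.prod.1 = n :=
  le_antisymm (idealRank_prod_le l hl fun z hz => (h.good z hz).2.le)
    (hr.trans (idealRank_mul_mul_le _ _ _))

theorem Run.nil {k n : ℕ} : Run sharp Good k n ([] : List (S × M)) := by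
  refine ⟨by simp, fun a b c habc hb => absurd ?_ hb⟩
  simp only [List.nil_eq, List.append_eq_nil_iff] at habc
  exact habc.1.2

/-- The gaps of the list `l`, put between `p` and `s`, have their labels (the product of
everything to the left and of everything to the right) in `T`. -/
def GapsIn (T : Finset (S × S)) (p s : S) (l : List (S × M)) : Prop :=
  ∀ a b, l = a ++ b → a ≠ [] → b ≠ [] → (p * a.prod.1, b.prod.1 * s) ∈ T

/-- The run is cut at all gaps labelled `(p, q)`. Each piece has no inner gap with this label, so
`hT` applies to it; a piece between two cuts leaves `p` fixed from the right and `q` from the left.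
The last piece `z` is kept apart because it ends at `s`, not at a cut. -/
theorem exists_blocks [Finite S] [DecidableEq S] {k K n : ℕ} {T : Finset (S × S)} {p q : S}
    (hT : ∀ (l : List (S × M)) (s : S), Run sharp Good k n l → l ≠ [] →
      n ≤ idealRank (p * l.prod.1 * s) → GapsIn (T.erase (p, q)) p s l → Good K l.prod)
    (m : ℕ) : ∀ (l : List (S × M)) (s : S), l.length ≤ m → Run sharp Good k n l → l ≠ [] →
      n ≤ idealRank (p * l.prod.1 * s) → l.prod.1 * s = q → GapsIn T p s l →
      ∃ (E : List (S × M)) (z : S × M), l.prod = E.prod * z ∧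
        (∀ y ∈ E, Good K y ∧ p * y.1 = p ∧ y.1 * q = q ∧ idealRank y.1 = n ∧
          (y.1 * y.1 = y.1 → sharp y.1 = y.1)) ∧
        p * E.prod.1 = p ∧ Good K z ∧ idealRank z.1 = n ∧ z.1 * s = q ∧
          (z.1 * z.1 = z.1 → sharp z.1 = z.1) := by
  induction m with
  | zero =>
    intro l s hm _ hl
    exact absurd (List.length_eq_zero_iff.1 (Nat.le_zero.1 hm)) hl
  | succ m ih =>
    intro l s hm hrun hl hr hq hgaps
    -- Both halves satisfy the same hypotheses, the left one with `q` in place of `s`; its last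
    -- piece then ends at the cut and joins the blocks.
    by_cases hsplit : ∃ a b, l = a ++ b ∧ a ≠ [] ∧ b ≠ [] ∧ (p * a.prod.1, b.prod.1 * s) = (p, q)
    · obtain ⟨a, b, rfl, ha, hb, hab⟩ := hsplit
      obtain ⟨hpa, hbq⟩ := Prod.mk.inj hab
      have ha' := List.length_pos_iff.2 ha
      have hb' := List.length_pos_iff.2 hb
      rw [List.length_append] at hm
      rw [List.prod_append, Prod.fst_mul] at hr hq
      obtain ⟨E₁, z₁, hE₁, hE₁', hpE₁, hz₁, hz₁n, hz₁q, hz₁s⟩ := ih a q (by omega) hrun.left ha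
        (by rw [← hbq]; simpa only [mul_assoc] using hr)
        (by rw [← hbq, ← mul_assoc]; exact hq.trans hbq.symm) (by
          intro x y hxy hx hy
          have := hgaps x (y ++ b) (by rw [hxy]; simp) hx (by simp [hy])
          rwa [List.prod_append, Prod.fst_mul, mul_assoc, hbq] at this)
      obtain ⟨E₂, z₂, hE₂, hE₂', hpE₂, hz₂, hz₂n, hz₂q, hz₂s⟩ := ih b s (by omega) hrun.right hb
        (by rw [← mul_assoc, hpa] at hr; exact hr) hbq (by
          intro x y hxy hx hy
          have := hgaps (a ++ x) y (by rw [hxy]; simp) (by simp [hx]) hy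
          rwa [List.prod_append, Prod.fst_mul, ← mul_assoc, hpa] at this)
      have hpz₁ : p * z₁.1 = p := by
        conv_lhs => rw [← hpE₁]
        rw [mul_assoc, ← Prod.fst_mul, ← hE₁, hpa]
      refine ⟨E₁ ++ z₁ :: E₂, z₂, ?_, ?_, ?_, hz₂, hz₂n, hz₂q, hz₂s⟩
      · rw [List.prod_append, List.prod_append, List.prod_cons, hE₁, hE₂]
        simp only [mul_assoc]
      · intro y hy
        rcases List.mem_append.1 hy with hy | hy
        · exact hE₁' y hy
        · rcases List.mem_cons.1 hy with rfl | hy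
          · exact ⟨hz₁, hpz₁, hz₁q, hz₁n, hz₁s⟩
          · exact hE₂' y hy
      · rw [List.prod_append, List.prod_cons, Prod.fst_mul, Prod.fst_mul, ← mul_assoc, hpE₁,
          ← mul_assoc, hpz₁, hpE₂]
    · refine ⟨[], l.prod, by simp, by simp, by simp, hT l s hrun hl hr ?_,
        hrun.idealRank_prod hl hr, hq, hrun.stable [] l [] (by simp) hl⟩
      intro a b hab ha hb
      exact Finset.mem_erase.2 ⟨fun h => hsplit ⟨a, b, hab, ha, hb, h⟩, hgaps a b hab ha hb⟩

/-- Induction on the number of gap labels. Cutting at every gap labelled like the first one leaves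
pieces with one label fewer. The blocks between cuts all equal one idempotent, which iteration does
not change in a run. The three extra levels are the iteration, the product with the last piece `z`
and the product with the first factor `x`. -/
theorem good_prod_of_gapsIn [Finite S] [DecidableEq S] (h : IsTreeFiltration sharp Good)
    {k n : ℕ} (t : ℕ) : ∀ (T : Finset (S × S)), T.card ≤ t → ∀ (l : List (S × M)) (p s : S),
      Run sharp Good k n l → l ≠ [] → n ≤ idealRank (p * l.prod.1 * s) → GapsIn T p s l →
      Good (k + 3 * t) l.prod := by
  induction t with
  | zero =>
    intro T hT l p s hrun hl hr hgaps
    obtain rfl := Finset.card_eq_zero.1 (Nat.le_zero.1 hT)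
    match l, hl with
    | [x], _ => simpa using (hrun.good x (by simp)).1
    | x :: y :: l, _ => exact absurd (hgaps [x] (y :: l) rfl (by simp) (by simp)) (by simp)
  | succ t ih =>
    intro T hT l p s hrun hl hr hgaps
    match l, hl with
    | [x], _ => simpa using h.mono (by omega) (hrun.good x (by simp)).1
    | x :: y :: l, _ =>
      set L := y :: l with hL
      have hLne : L ≠ [] := by simp [hL]
      have hrun' : Run sharp Good k n L := Run.right (a := [x]) hrun
      have hx := hrun.good x (by simp)
      have hmem : (p * x.1, L.prod.1 * s) ∈ T := by
        simpa using hgaps [x] L rfl (by simp) hLne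
      have hr' : n ≤ idealRank (p * x.1 * L.prod.1 * s) := by
        rw [List.prod_cons, Prod.fst_mul] at hr
        simpa only [mul_assoc] using hr
      obtain ⟨E, z, hEz, hE, -, hz, -⟩ := exists_blocks (K := k + 3 * t) (k := k) (n := n)
        (p := p * x.1) (q := L.prod.1 * s) (T := T) (sharp := sharp) (Good := Good)
        (fun l' s' hl' hne hrl hg => ih _ (by
          rw [Finset.card_erase_of_mem hmem]; omega) l' (p * x.1) s' hl' hne hrl hg)
        L.length L s le_rfl hrun' hLne hr' rfl (by
          intro a b hab ha hb
          have := hgaps (x :: a) b (by rw [hab]; rfl) (by simp) hb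
          rwa [List.prod_cons, Prod.fst_mul, ← mul_assoc] at this)
      have hxg : ∀ j, Good (k + j) x := fun j => h.mono (by omega) hx.1
      have hpn : n ≤ idealRank (p * x.1) := by
        rw [mul_assoc] at hr'
        exact hr'.trans (idealRank_mul_le_left _ _)
      have hqn : n ≤ idealRank (L.prod.1 * s) := by
        rw [mul_assoc] at hr'
        exact hr'.trans (idealRank_mul_le_right _ _)
      rw [List.prod_cons, hEz]
      match E, hE with
      | [], _ =>
        rw [List.prod_nil, one_mul]
        exact h.mono (by omega) (h.mul _ _ _ (hxg (3 * t)) hz)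
      | y₀ :: E, hE =>
        have hy₀ := hE y₀ (by simp)
        have hid : y₀.1 * y₀.1 = y₀.1 := (eq_mul_of_fixes hy₀.2.1 hy₀.2.1 hy₀.2.2.1 hy₀.2.2.1
          (hy₀.2.2.2.1 ▸ hpn) (hy₀.2.2.2.1 ▸ hqn)).1
        have hall : ∀ y ∈ y₀ :: E, y.1 = y₀.1 := by
          intro y hy
          have hy' := hE y hy
          obtain ⟨h1, h2⟩ := eq_mul_of_fixes hy'.2.1 hy₀.2.1 hy'.2.2.1 hy₀.2.2.1
            (hy'.2.2.2.1 ▸ hpn) (hy₀.2.2.2.1 ▸ hqn)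
          exact h1.symm.trans h2
        have hprod : Good (k + 3 * t + 1) (y₀ :: E).prod := by
          have hiter := h.iter (k + 3 * t) y₀.1 (y₀ :: E) hid (by simp)
            fun y hy => ⟨hall y hy, (hE y hy).1⟩
          rw [hy₀.2.2.2.2 hid] at hiter
          have hfst := prod_fst_eq hid (y₀ :: E) (by simp) hall
          convert hiter using 1
          exact Prod.ext hfst rfl
        exact h.mul _ _ _ (hxg _) (h.mul _ _ _ hprod (h.succ _ _ hz))

theorem exists_good_prod_of_run [Finite S] (h : IsTreeFiltration sharp Good) (k n : ℕ) :
    ∃ K, k ≤ K ∧ ∀ l : List (S × M), Run sharp Good k n l → (l ≠ [] → n ≤ idealRank l.prod.1) →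
      Good K l.prod := by
  classical
  have := Fintype.ofFinite S
  refine ⟨k + 3 * (Finset.univ : Finset (S × S)).card, by omega, fun l hl hr => ?_⟩
  rcases eq_or_ne l [] with rfl | hne
  · exact h.mono (Nat.zero_le _) h.one
  · exact h.good_prod_of_gapsIn _ Finset.univ le_rfl l 1 1 hl hne (by simpa using hr hne)
      fun _ _ _ _ _ => Finset.mem_univ _

/-- The list is read from left to right: `E` holds finished trees of rank at most `n`, `C` the
current run of rank `n + 1`. The run is closed when the next factor lowers the rank, or when it
completes an idempotent that iteration changes. Since iteration alters labels, only second
components are preserved. The three levels above `K` are `b.prod * x`, its iteration and the product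
with `a.prod`. -/
theorem exists_lower_rank [Finite S] (hs : IsIteration sharp) (h : IsTreeFiltration sharp Good)
    (k n : ℕ) : ∃ K, k ≤ K ∧ ∀ l : List (S × M), (∀ z ∈ l, Good k z ∧ idealRank z.1 ≤ n + 1) →
      ∃ (E : List (S × M)) (z : S × M), (∀ y ∈ E, Good K y ∧ idealRank y.1 ≤ n) ∧ Good K z ∧
        l.prod.2 = E.prod.2 * z.2 := by
  obtain ⟨K, hkK, hK⟩ := h.exists_good_prod_of_run k (n + 1)
  refine ⟨K + 3, by omega, fun l hl => ?_⟩
  suffices H : ∃ E C : List (S × M), (∀ y ∈ E, Good (K + 3) y ∧ idealRank y.1 ≤ n) ∧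
      Run sharp Good k (n + 1) C ∧ (C ≠ [] → n + 1 ≤ idealRank C.prod.1) ∧
      l.prod.2 = E.prod.2 * C.prod.2 by
    obtain ⟨E, C, hE, hC, hr, hprod⟩ := H
    exact ⟨E, C.prod, hE, h.mono (by omega) (hK C hC hr), hprod⟩
  induction l using List.reverseRecOn with
  | nil => exact ⟨[], [], by simp, Run.nil, by simp, by simp⟩
  | append_singleton l x ih =>
    obtain ⟨E, C, hE, hC, hr, hprod⟩ := ih fun z hz => hl z (by simp [hz])
    have hx := hl x (by simp)
    have hxK : Good K x := h.mono hkK hx.1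
    have push : ∀ y : S × M, Good (K + 3) y → idealRank y.1 ≤ n → y.2 = C.prod.2 * x.2 →
        ∃ E C : List (S × M), (∀ y ∈ E, Good (K + 3) y ∧ idealRank y.1 ≤ n) ∧
          Run sharp Good k (n + 1) C ∧ (C ≠ [] → n + 1 ≤ idealRank C.prod.1) ∧
          (l ++ [x]).prod.2 = E.prod.2 * C.prod.2 := by
      intro y hy hyn hyx
      refine ⟨E ++ [y], [], ?_, Run.nil, by simp, ?_⟩
      · intro z hz
        rcases List.mem_append.1 hz with hz | hz
        · exact hE z hz
        · rw [List.mem_singleton.1 hz]; exact ⟨hy, hyn⟩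
      · simp [hprod, hyx, mul_assoc]
    have hCx : Good (K + 3) (C.prod * x) := h.mono (by omega) (h.mul _ _ _ (hK C hC hr) hxK)
    by_cases hrank : idealRank (C.prod.1 * x.1) ≤ n
    · exact push _ hCx hrank rfl
    have hxn : idealRank x.1 = n + 1 := by
      have := idealRank_mul_le_right C.prod.1 x.1
      omega
    by_cases hst : Run sharp Good k (n + 1) (C ++ [x])
    · refine ⟨E, C ++ [x], hE, hst, fun _ => ?_, by simp [hprod, mul_assoc]⟩
      rw [List.prod_append, List.prod_singleton, Prod.fst_mul]
      omega
    -- The idempotent that iteration changes must end at `x`, as otherwise it would lie inside the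
    -- run `C`; `b` may be empty.
    obtain ⟨a, b, hab, hid, hne⟩ : ∃ a b : List (S × M), C = a ++ b ∧
        (b.prod * x).1 * (b.prod * x).1 = (b.prod * x).1 ∧
        sharp (b.prod * x).1 ≠ (b.prod * x).1 := by
      by_contra hcon
      push Not at hcon
      refine hst ⟨?_, ?_⟩
      · intro z hz
        rcases List.mem_append.1 hz with hz | hz
        · exact hC.good z hz
        · rw [List.mem_singleton.1 hz]; exact ⟨hx.1, hxn⟩
      · intro a b c habc hb hid
        rcases List.eq_nil_or_concat c with rfl | ⟨c, y, rfl⟩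
        · rcases List.eq_nil_or_concat b with rfl | ⟨b, y, rfl⟩
          · exact absurd rfl hb
          · rw [List.append_nil, List.concat_eq_append, ← List.append_assoc] at habc
            obtain ⟨h1, h2⟩ := List.append_inj' habc rfl
            obtain rfl : x = y := by simpa using h2
            have hp : (b.concat x).prod = b.prod * x := by simp
            rw [hp] at hid ⊢
            exact hcon a b h1 hid
        · rw [List.concat_eq_append, ← List.append_assoc] at habc
          exact hC.stable a b c (List.append_inj' habc rfl).1 hb hid
    subst hab
    have hgb : Good K b.prod := hK b hC.right fun hb => by
      have := hr (by simp [hb])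
      rw [List.prod_append, Prod.fst_mul] at this
      exact this.trans (idealRank_mul_le_right _ _)
    have hga : Good K a.prod := hK a hC.left fun ha => by
      have := hr (by simp [ha])
      rw [List.prod_append, Prod.fst_mul] at this
      exact this.trans (idealRank_mul_le_left _ _)
    have hbx := h.mul _ _ _ hgb hxK
    have hsharp := h.iter (K + 1) (b.prod * x).1 [b.prod * x] hid (by simp) (by simpa using hbx)
    have hlt := hs.idealRank_lt hid hne
    have hle : idealRank (b.prod * x).1 ≤ n + 1 := hxn ▸ idealRank_mul_le_right _ _
    refine push (a.prod * (sharp (b.prod * x).1, (b.prod * x).2)) ?_ ?_ ?_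
    · refine h.mul _ _ _ (h.mono (by omega) hga) ?_
      simpa using hsharp
    · have := idealRank_mul_le_right a.prod.1 (sharp (b.prod * x).1)
      change idealRank (a.prod.1 * sharp (b.prod * x).1) ≤ n
      omega
    · simp [mul_assoc]

/-- A factorization forest theorem: if every generator has a tree of height `0`, then all products
of generators have trees of bounded height. -/
theorem exists_bound [Finite S] (hs : IsIteration sharp) (h : IsTreeFiltration sharp Good)
    {X : Set M} (hX : ∀ m ∈ X, ∃ x, Good 0 (x, m)) :
    ∃ K, ∀ l : List M, (∀ m ∈ l, m ∈ X) → ∃ x, Good K (x, l.prod) := by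
  have key : ∀ n ≤ Nat.card S, ∃ K, ∀ l : List M, (∀ m ∈ l, m ∈ X) →
      ∃ (E : List (S × M)) (z : S × M), (∀ y ∈ E, Good K y ∧ idealRank y.1 ≤ n) ∧ Good K z ∧
        l.prod = E.prod.2 * z.2 := by
    intro n hn
    induction hn using Nat.decreasingInduction with
    | self =>
      refine ⟨0, fun l hl => ?_⟩
      suffices H : ∃ E : List (S × M), (∀ y ∈ E, Good 0 y) ∧ l.prod = E.prod.2 by
        obtain ⟨E, hE, hprod⟩ := H
        exact ⟨E, 1, fun y hy => ⟨hE y hy, idealRank_le_card _⟩, h.one, by simp [hprod]⟩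
      induction l with
      | nil => exact ⟨[], by simp, by simp⟩
      | cons m l ih =>
        obtain ⟨E, hE, hprod⟩ := ih fun y hy => hl y (by simp [hy])
        obtain ⟨x, hx⟩ := hX m (hl m (by simp))
        refine ⟨(x, m) :: E, ?_, by simp [hprod]⟩
        intro y hy
        rcases List.mem_cons.1 hy with rfl | hy
        · exact hx
        · exact hE y hy
    | of_succ n _ ih =>
      obtain ⟨k, hk⟩ := ih
      obtain ⟨K, hkK, hK⟩ := exists_lower_rank hs h k n
      refine ⟨K + 1, fun l hl => ?_⟩
      obtain ⟨E, z, hE, hz, hprod⟩ := hk l hl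
      obtain ⟨E', z', hE', hz', hprod'⟩ := hK E hE
      exact ⟨E', z' * z, fun y hy => ⟨h.succ _ _ (hE' y hy).1, (hE' y hy).2⟩,
        h.mul _ _ _ hz' (h.mono hkK hz), by rw [hprod, hprod', Prod.snd_mul, mul_assoc]⟩
  obtain ⟨K, hK⟩ := key 0 (Nat.zero_le _)
  refine ⟨K, fun l hl => ?_⟩
  obtain ⟨E, z, hE, hz, hprod⟩ := hK l hl
  -- Ranks are positive, so at level `0` only the remainder `z` is left.
  obtain rfl : E = [] := by
    refine List.eq_nil_iff_forall_not_mem.2 fun y hy => ?_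
    have := (hE y hy).2
    have := idealRank_pos y.1
    omega
  refine ⟨z.1, ?_⟩
  rw [hprod]
  simpa using hz

end IsTreeFiltration

end Factorization

/-! ### The monoid of limit-words and its iteration -/

namespace LimitWord

variable {Q : Type*}

instance : Monoid (LimitWord Q) where
  one_mul u := by
    ext s t
    exact ⟨fun ⟨_, h, h'⟩ => by cases h; exact h', fun h => ⟨s, rfl, h⟩⟩
  mul_one u := by
    ext s t
    exact ⟨fun ⟨_, h, h'⟩ => by cases h'; exact h, fun h => ⟨t, h, rfl⟩⟩
  mul_assoc u v w := by
    ext s t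
    exact ⟨fun ⟨q, ⟨r, h₁, h₂⟩, h₃⟩ => ⟨r, h₁, q, h₂, h₃⟩,
      fun ⟨r, h₁, q, h₂, h₃⟩ => ⟨q, ⟨r, h₁, h₂⟩, h₃⟩⟩

instance [Finite Q] : Finite (LimitWord Q) :=
  Finite.of_injective LimitWord.edge fun _ _ h => LimitWord.ext h

theorem edge_trans {u : LimitWord Q} (hu : u * u = u) {a b c : Q} (hab : u.edge a b)
    (hbc : u.edge b c) : u.edge a c := by
  have h : (u * u).edge a c := ⟨b, hab, hbc⟩
  rwa [hu] at h

theorem Recurrent.edge_self {u : LimitWord Q} (hu : u * u = u) {t : Q} (ht : u.Recurrent t) :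
    u.edge t t := by
  obtain ⟨q, hq⟩ := u.exists_edge t
  exact edge_trans hu hq (ht q hq)

theorem Recurrent.of_edge {u : LimitWord Q} (hu : u * u = u) {s t : Q} (hs : u.Recurrent s)
    (h : u.edge s t) : u.Recurrent t :=
  fun x hx => edge_trans hu (hs x (edge_trans hu h hx)) h

open Classical in
/-- Iteration, extended by the identity to all limit-words. -/
noncomputable def sharp [Finite Q] (u : LimitWord Q) : LimitWord Q :=
  if hu : u * u = u then u.iter hu else u

theorem sharp_of_idem [Finite Q] {u : LimitWord Q} (hu : u * u = u) : u.sharp = u.iter hu :=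
  dif_pos hu

theorem isIteration_sharp [Finite Q] : IsIteration (sharp (Q := Q)) where
  idem u hu := by
    rw [sharp_of_idem hu]
    ext s t
    exact ⟨fun ⟨_, h, h'⟩ => ⟨edge_trans hu h.1 h'.1, h'.2⟩, fun h => ⟨t, h, h.2.edge_self hu, h.2⟩⟩
  mul_left u hu := by
    rw [sharp_of_idem hu]
    ext s t
    exact ⟨fun ⟨_, h, h'⟩ => ⟨edge_trans hu h h'.1, h'.2⟩, fun h => ⟨t, h.1, h.2.edge_self hu, h.2⟩⟩
  mul_right u hu := by
    rw [sharp_of_idem hu]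
    ext s t
    exact ⟨fun ⟨_, h, h'⟩ => ⟨edge_trans hu h.1 h', h.2.of_edge hu h'⟩,
      fun h => ⟨t, h, h.2.edge_self hu⟩⟩

/-- The first component will be the support of actual words. Powers of words with idempotent support
keep that support, so iteration acts on the limit component only. -/
theorem isIteration_prod_sharp [Finite Q] : IsIteration
    fun x : LimitWord Q × LimitWord Q => (x.1, x.2.sharp) where
  idem e he := Prod.ext (Prod.ext_iff.1 he).1
    (isIteration_sharp.idem e.2 (congrArg Prod.snd he))
  mul_left e he := Prod.ext (Prod.ext_iff.1 he).1
    (isIteration_sharp.mul_left e.2 (congrArg Prod.snd he))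
  mul_right e he := Prod.ext (Prod.ext_iff.1 he).1
    (isIteration_sharp.mul_right e.2 (congrArg Prod.snd he))

end LimitWord

theorem exists_pos_forall_le_of_finite {ι : Type*} [Finite ι] {f : ι → ℝ} (hf : ∀ i, 0 < f i) :
    ∃ p : ℝ, 0 < p ∧ ∀ i, p ≤ f i := by
  cases isEmpty_or_nonempty ι
  · exact ⟨1, one_pos, fun i => isEmptyElim i⟩
  · obtain ⟨i, hi⟩ := Finite.exists_min f
    exact ⟨f i, hf i, hi⟩

/-! ### Stochastic matrices and their supports -/

section Stochastic

open Matrix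

variable {Q : Type*}

/-- The limit-word `v` is the support of the matrix `m`. -/
def HasSupport (m : Matrix Q Q ℝ) (v : LimitWord Q) : Prop :=
  ∀ s t, v.edge s t ↔ 0 < m s t

theorem hasSupport_one [DecidableEq Q] : HasSupport (1 : Matrix Q Q ℝ) 1 := by
  intro s t
  change s = t ↔ _
  rcases eq_or_ne s t with rfl | h
  · simp
  · simp [h]

theorem exists_le_of_hasSupport [Finite Q] {m : Matrix Q Q ℝ} {u : LimitWord Q} (h : HasSupport m u) :
    ∃ δ : ℝ, 0 < δ ∧ δ ≤ 1 ∧ ∀ s t, u.edge s t → δ ≤ m s t := by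
  classical
  obtain ⟨δ, hδ, hle⟩ := exists_pos_forall_le_of_finite
    (f := fun x : Q × Q => if u.edge x.1 x.2 then m x.1 x.2 else 1) (by
      intro x
      split_ifs with hx
      · exact (h _ _).1 hx
      · exact one_pos)
  refine ⟨min δ 1, lt_min hδ one_pos, min_le_right _ _, fun s t hst => ?_⟩
  have := hle (s, t)
  simp only [hst, if_true] at this
  exact (min_le_left _ _).trans this

variable [Fintype Q] [DecidableEq Q]

theorem nonneg_of_rowStochastic {m : Matrix Q Q ℝ} (hm : m ∈ rowStochastic ℝ Q) (s t : Q) :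
    0 ≤ m s t :=
  (mem_rowStochastic_iff_sum.1 hm).1 s t

theorem sum_of_rowStochastic {m : Matrix Q Q ℝ} (hm : m ∈ rowStochastic ℝ Q) (s : Q) :
    ∑ t, m s t = 1 :=
  (mem_rowStochastic_iff_sum.1 hm).2 s

theorem le_one_of_mem_rowStochastic {m : Matrix Q Q ℝ} (hm : m ∈ rowStochastic ℝ Q) (s t : Q) :
    m s t ≤ 1 :=
  sum_of_rowStochastic hm s ▸ Finset.single_le_sum (fun q _ => nonneg_of_rowStochastic hm s q)
    (Finset.mem_univ t)

theorem mul_apply_le_of_rowStochastic {m m' : Matrix Q Q ℝ} (hm : m ∈ rowStochastic ℝ Q)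
    (hm' : m' ∈ rowStochastic ℝ Q) (s q t : Q) : m s q * m' q t ≤ (m * m') s t := by
  rw [Matrix.mul_apply]
  exact Finset.single_le_sum (f := fun q => m s q * m' q t)
    (fun q _ => mul_nonneg (nonneg_of_rowStochastic hm s q) (nonneg_of_rowStochastic hm' q t))
    (Finset.mem_univ q)

theorem HasSupport.mul {m m' : Matrix Q Q ℝ} {v v' : LimitWord Q} (hm : m ∈ rowStochastic ℝ Q)
    (hm' : m' ∈ rowStochastic ℝ Q) (h : HasSupport m v) (h' : HasSupport m' v') :
    HasSupport (m * m') (v * v') := by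
  intro s t
  constructor
  · rintro ⟨q, hq, hq'⟩
    exact (mul_pos ((h s q).1 hq) ((h' q t).1 hq')).trans_le
      (mul_apply_le_of_rowStochastic hm hm' s q t)
  · intro hpos
    rw [Matrix.mul_apply] at hpos
    obtain ⟨q, -, hq⟩ := Finset.exists_lt_of_sum_lt (s := Finset.univ) (f := fun _ : Q => (0 : ℝ))
      (g := fun q => m s q * m' q t) (by simpa using hpos)
    have h1 := nonneg_of_rowStochastic hm s q
    have h2 := nonneg_of_rowStochastic hm' q t
    exact ⟨q, (h s q).2 (pos_of_mul_pos_left hq h2), (h' q t).2 (pos_of_mul_pos_right hq h1)⟩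

theorem HasSupport.list_prod {v : LimitWord Q} (hv : v * v = v) :
    ∀ l : List (Matrix Q Q ℝ), l ≠ [] → (∀ m ∈ l, m ∈ rowStochastic ℝ Q ∧ HasSupport m v) →
      HasSupport l.prod v
  | [], h, _ => absurd rfl h
  | [m], _, h => by simpa using (h m (by simp)).2
  | m :: m' :: l, _, h => by
    have ih := HasSupport.list_prod hv (m' :: l) (by simp) fun y hy => h y (by simp_all)
    rw [List.prod_cons, ← hv]
    exact (h m (by simp)).2.mul (h m (by simp)).1
      (Submonoid.list_prod_mem _ fun y hy => (h y (by simp_all)).1) ih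

/-- All factors but the last keep the chain inside `C`, and averaging over `C` preserves the bound,
so nothing is lost with the length. -/
theorem le_list_prod_of_closed {C : Q → Prop} {δ : ℝ} {t : Q} :
    ∀ l : List (Matrix Q Q ℝ), l ≠ [] → (∀ m ∈ l, m ∈ rowStochastic ℝ Q ∧
      (∀ q q', C q → 0 < m q q' → C q') ∧ ∀ q, C q → δ ≤ m q t) → ∀ q, C q → δ ≤ l.prod q t
  | [], h, _ => absurd rfl h
  | [m], _, h => by simpa using (h m (by simp)).2.2
  | m :: m' :: l, _, h => by
    intro q hq
    have ih := le_list_prod_of_closed (m' :: l) (by simp) fun y hy => h y (by simp_all)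
    obtain ⟨hm, hC, -⟩ := h m (by simp)
    rw [List.prod_cons, Matrix.mul_apply]
    calc δ = ∑ q', m q q' * δ := by rw [← Finset.sum_mul, sum_of_rowStochastic hm, one_mul]
      _ ≤ ∑ q', m q q' * (m' :: l).prod q' t := by
        refine Finset.sum_le_sum fun q' _ => ?_
        rcases (nonneg_of_rowStochastic hm q q').eq_or_lt with h0 | h0
        · rw [← h0]; simp
        · exact mul_le_mul_of_nonneg_left (ih q' (hC q q' hq h0)) h0.le

/-- If nothing leaks out of the `u`-recurrent states, then the entries of a product that belong to
the iteration of `u` are bounded below independently of the number of factors. -/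
theorem sq_le_list_prod {u v : LimitWord Q} (hu : u * u = u) (hv : v * v = v)
    (hleak : ∀ r q, u.Recurrent r → v.edge r q → u.edge q r) {δ : ℝ} (hδ : 0 ≤ δ) (hδ1 : δ ≤ 1)
    (l : List (Matrix Q Q ℝ)) (hl : l ≠ []) (h : ∀ m ∈ l, m ∈ rowStochastic ℝ Q ∧ HasSupport m v ∧
      ∀ s t, u.edge s t → δ ≤ m s t) {s t : Q} (hst : (u.iter hu).edge s t) :
    δ ^ 2 ≤ l.prod s t := by
  obtain ⟨hst, ht⟩ := hst
  match l, hl with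
  | [m], _ =>
    have := (h m (by simp)).2.2 s t hst
    rw [List.prod_singleton]
    nlinarith
  | m :: m' :: l, _ =>
    have hm := h m (by simp)
    have hmem : (m' :: l).prod ∈ rowStochastic ℝ Q :=
      Submonoid.list_prod_mem _ fun y hy => (h y (by simp_all)).1
    have htt : δ ≤ (m' :: l).prod t t := by
      -- After a first step from `s` to `t`, the chain stays in this set; by `hleak` each of its
      -- states has a `u`-edge back to `t`, hence probability at least `δ` of going there in the
      -- last step.
      refine le_list_prod_of_closed (C := fun q => q = t ∨ v.edge t q) (m' :: l) (by simp) ?_ t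
        (Or.inl rfl)
      intro y hy
      obtain ⟨hy1, hy2, hy3⟩ := h y (by simp_all)
      refine ⟨hy1, ?_, ?_⟩
      · rintro q q' (rfl | hq) hpos
        · exact Or.inr ((hy2 _ _).2 hpos)
        · exact Or.inr (LimitWord.edge_trans hv hq ((hy2 _ _).2 hpos))
      · rintro q (rfl | hq)
        · exact hy3 _ _ (ht.edge_self hu)
        · exact hy3 _ _ (hleak t q ht hq)
    rw [List.prod_cons, sq]
    exact (mul_le_mul (hm.2.2 s t hst) htt hδ (nonneg_of_rowStochastic hm.1 s t)).trans
      (mul_apply_le_of_rowStochastic hm.1 hmem s t t)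

/-- Recurrent states never lead to `t`, and from every state a step enters a recurrent one with
probability at least `δ`. -/
theorem pow_apply_le_of_not_recurrent {P : Matrix Q Q ℝ} (hP : P ∈ rowStochastic ℝ Q)
    {u : LimitWord Q} (hu : u * u = u) (hPu : HasSupport P u) {δ : ℝ} (hδ1 : δ ≤ 1)
    (hδ : ∀ s t, u.edge s t → δ ≤ P s t) {t : Q} (ht : ¬ u.Recurrent t) (k : ℕ) (s : Q) :
    (P ^ k) s t ≤ (1 - δ) ^ k := by
  have hz : ∀ k s, u.Recurrent s → (P ^ k) s t ≤ 0 := by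
    intro k s hs
    cases k with
    | zero =>
      have : s ≠ t := fun h => ht (h ▸ hs)
      simp [this]
    | succ k =>
      by_contra! hpos
      have hsup : HasSupport (P ^ (k + 1)) u := by
        rw [← List.prod_replicate]
        exact HasSupport.list_prod hu _ (by simp) fun m hm => by
          rw [List.eq_of_mem_replicate hm]; exact ⟨hP, hPu⟩
      exact ht (hs.of_edge hu ((hsup s t).2 hpos))
  induction k generalizing s with
  | zero => simpa using le_one_of_mem_rowStochastic (one_mem (rowStochastic ℝ Q)) s t
  | succ k ih =>
    obtain ⟨r, hsr, hr⟩ := u.exists_edge_recurrent hu s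
    have hnn : 0 ≤ (1 - δ) ^ k := pow_nonneg (by linarith) k
    rw [pow_succ', Matrix.mul_apply, ← Finset.add_sum_erase _ _ (Finset.mem_univ r)]
    have h1 : P s r * (P ^ k) r t ≤ 0 :=
      mul_nonpos_of_nonneg_of_nonpos (nonneg_of_rowStochastic hP s r) (hz k r hr)
    have h2 : ∑ q ∈ Finset.univ.erase r, P s q * (P ^ k) q t ≤
        (∑ q ∈ Finset.univ.erase r, P s q) * (1 - δ) ^ k := by
      rw [Finset.sum_mul]
      exact Finset.sum_le_sum fun q _ =>
        mul_le_mul_of_nonneg_left (ih q) (nonneg_of_rowStochastic hP s q)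
    have h3 : P s r + ∑ q ∈ Finset.univ.erase r, P s q = 1 := by
      rw [Finset.add_sum_erase _ _ (Finset.mem_univ r), sum_of_rowStochastic hP]
    have h4 : (∑ q ∈ Finset.univ.erase r, P s q) * (1 - δ) ^ k ≤ (1 - δ) * (1 - δ) ^ k :=
      mul_le_mul_of_nonneg_right (by linarith [hδ s r hsr]) hnn
    rw [pow_succ']
    linarith

/-- Along a subsequence, the powers of a stochastic matrix with idempotent support converge to a
matrix whose support is the iteration of that support. -/
theorem exists_tendsto_pow {P : Matrix Q Q ℝ} (hP : P ∈ rowStochastic ℝ Q)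
    {u : LimitWord Q} (hu : u * u = u) (hPu : HasSupport P u) :
    ∃ (ψ : ℕ → ℕ) (N : Matrix Q Q ℝ), StrictMono ψ ∧
      (∀ s t, Tendsto (fun j => (P ^ (ψ j + 1)) s t) atTop (𝓝 (N s t))) ∧
      HasSupport N (u.iter hu) := by
  obtain ⟨δ, hδ0, hδ1, hδ⟩ := exists_le_of_hasSupport hPu
  have hpow : ∀ k, P ^ k ∈ rowStochastic ℝ Q := fun k => pow_mem hP k
  have hcomp : IsCompact (Set.pi Set.univ fun _ : Q => Set.pi Set.univ fun _ : Q =>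
      Set.Icc (0 : ℝ) 1) := isCompact_univ_pi fun _ => isCompact_univ_pi fun _ => isCompact_Icc
  obtain ⟨N, -, ψ, hψ, hN⟩ := hcomp.tendsto_subseq (x := fun k : ℕ => fun s t => (P ^ (k + 1)) s t)
    fun k s _ t _ => ⟨nonneg_of_rowStochastic (hpow _) s t,
      le_one_of_mem_rowStochastic (hpow _) s t⟩
  have hN' : ∀ s t, Tendsto (fun j => (P ^ (ψ j + 1)) s t) atTop (𝓝 (N s t)) := fun s t =>
    tendsto_pi_nhds.1 (tendsto_pi_nhds.1 hN s) t
  have hsup : ∀ k, HasSupport (P ^ (k + 1)) u := fun k => by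
    rw [← List.prod_replicate]
    exact HasSupport.list_prod hu _ (by simp) fun m hm => by
      rw [List.eq_of_mem_replicate hm]; exact ⟨hP, hPu⟩
  refine ⟨ψ, N, hψ, hN', fun s t => ⟨fun hst => ?_, fun hpos => ⟨?_, ?_⟩⟩⟩
  · refine (pow_pos hδ0 2).trans_le (ge_of_tendsto' (hN' s t) fun j => ?_)
    rw [← List.prod_replicate (ψ j + 1) P]
    -- With all factors equal to `P` and `v = u`, the no-leak hypothesis is recurrence itself.
    refine sq_le_list_prod hu hu (fun r q hr hq => hr q hq) hδ0.le hδ1 (List.replicate (ψ j + 1) P)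
      (by simp) ?_ hst
    intro m hm
    rw [List.eq_of_mem_replicate hm]
    exact ⟨hP, hPu, hδ⟩
  · obtain ⟨j, hj⟩ := ((hN' s t).eventually (lt_mem_nhds hpos)).exists
    exact (hsup _ s t).2 hj
  · by_contra hrec
    have hlim : Tendsto (fun j => (1 - δ) ^ (ψ j + 1)) atTop (𝓝 0) :=
      (tendsto_pow_atTop_nhds_zero_of_lt_one (by linarith) (by linarith)).comp
        ((tendsto_add_atTop_nat 1).comp hψ.tendsto_atTop)
    have := le_of_tendsto_of_tendsto' (hN' s t) hlim fun j =>
      pow_apply_le_of_not_recurrent hP hu hPu hδ1 hδ hrec _ s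
    linarith

end Stochastic

/-! ### Consistency and completeness of the Markov monoid -/

namespace ProbAutomaton

open Matrix

variable {Q A : Type*} [Fintype Q] [DecidableEq Q] (𝒜 : ProbAutomaton Q A)

theorem prob_append (w w' : List A) : 𝒜.prob (w ++ w') = 𝒜.prob w * 𝒜.prob w' := by
  simp [prob]

theorem prob_replicate_flatten (k : ℕ) (w : List A) :
    𝒜.prob (List.replicate k w).flatten = 𝒜.prob w ^ k := by
  induction k with
  | zero => simp [prob]
  | succ k ih => rw [List.replicate_succ, List.flatten_cons, prob_append, ih, pow_succ']

theorem prob_mem (w : List A) : 𝒜.prob w ∈ rowStochastic ℝ Q :=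
  Submonoid.list_prod_mem _ fun m hm => by
    obtain ⟨a, -, rfl⟩ := List.mem_map.1 hm
    exact 𝒜.trans_stochastic a

variable {𝒜}

theorem Reifies.exists_limit {w : ℕ → List A} {u : LimitWord Q} (h : 𝒜.Reifies w u) :
    ∃ P : Matrix Q Q ℝ, Tendsto (fun n => 𝒜.prob (w n)) atTop (𝓝 P) ∧ HasSupport P u ∧
      P ∈ rowStochastic ℝ Q := by
  choose P hP hPu using h
  change Matrix Q Q ℝ at P
  refine ⟨P, tendsto_pi_nhds.2 fun s => tendsto_pi_nhds.2 fun t => hP s t, hPu, ?_⟩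
  rw [mem_rowStochastic_iff_sum]
  refine ⟨fun s t => ge_of_tendsto' (hP s t) fun n =>
    nonneg_of_rowStochastic (𝒜.prob_mem _) s t, fun s => ?_⟩
  refine tendsto_nhds_unique (tendsto_finsetSum _ fun t _ => hP s t) ?_
  simp_rw [sum_of_rowStochastic (𝒜.prob_mem _)]
  exact tendsto_const_nhds

theorem reifies_of_tendsto {w : ℕ → List A} {u : LimitWord Q} {P : Matrix Q Q ℝ}
    (h : Tendsto (fun n => 𝒜.prob (w n)) atTop (𝓝 P)) (hP : HasSupport P u) : 𝒜.Reifies w u :=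
  fun s t => ⟨P s t, tendsto_pi_nhds.1 (tendsto_pi_nhds.1 h s) t, hP s t⟩

theorem reifies_const {w : List A} {u : LimitWord Q} (h : HasSupport (𝒜.prob w) u) :
    𝒜.Reifies (fun _ => w) u :=
  reifies_of_tendsto tendsto_const_nhds h

theorem Reifies.mul {w w' : ℕ → List A} {u u' : LimitWord Q} (h : 𝒜.Reifies w u)
    (h' : 𝒜.Reifies w' u') : 𝒜.Reifies (fun n => w n ++ w' n) (u * u') := by
  obtain ⟨P, hP, hPu, hPs⟩ := h.exists_limit
  obtain ⟨P', hP', hPu', hPs'⟩ := h'.exists_limit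
  refine reifies_of_tendsto (P := P * P') ?_ (hPu.mul hPs hPs' hPu')
  simp_rw [prob_append]
  exact hP.mul hP'

/-- Diagonal argument: for each exponent `k + 1`, continuity gives an index at which that power of
the word matrix is within `1 / (k + 1)` of the same power of the limit. The explicit form, with
exponents at least one, lets supports be tracked in `Realizes.iter`. -/
theorem Reifies.iter {w : ℕ → List A} {u : LimitWord Q} (hu : u * u = u) (h : 𝒜.Reifies w u) :
    ∃ φ k : ℕ → ℕ, 𝒜.Reifies (fun n => (List.replicate (k n + 1) (w (φ n))).flatten)
      (u.iter hu) := by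
  obtain ⟨P, hP, hPu, hPs⟩ := h.exists_limit
  obtain ⟨ψ, N, hψ, hN, hNu⟩ := exists_tendsto_pow hPs hu hPu
  have happrox : ∀ k : ℕ, ∃ n, ∀ s t,
      |(𝒜.prob (w n) ^ (k + 1)) s t - (P ^ (k + 1)) s t| < 1 / ((k : ℝ) + 1) := by
    intro k
    have hk : Tendsto (fun n => 𝒜.prob (w n) ^ (k + 1)) atTop (𝓝 (P ^ (k + 1))) := hP.pow _
    have hev : ∀ᶠ n in atTop, ∀ s t,
        |(𝒜.prob (w n) ^ (k + 1)) s t - (P ^ (k + 1)) s t| < 1 / ((k : ℝ) + 1) := by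
      refine eventually_all.2 fun s => eventually_all.2 fun t => ?_
      exact (Metric.tendsto_nhds.1 (tendsto_pi_nhds.1 (tendsto_pi_nhds.1 hk s) t)) _
        Nat.one_div_pos_of_nat
    exact hev.exists
  choose φ hφ using happrox
  refine ⟨fun j => φ (ψ j), ψ, fun s t => ⟨N s t, ?_, hNu s t⟩⟩
  simp_rw [prob_replicate_flatten]
  have hdiff : Tendsto (fun j => (𝒜.prob (w (φ (ψ j))) ^ (ψ j + 1)) s t - (P ^ (ψ j + 1)) s t)
      atTop (𝓝 0) :=
    squeeze_zero_norm (fun j => (hφ (ψ j) s t).le)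
      (tendsto_one_div_add_atTop_nhds_zero_nat.comp hψ.tendsto_atTop)
  simpa using hdiff.add (hN s t)

theorem hasSupport_prob_nil : HasSupport (𝒜.prob []) 1 := by
  simpa [prob] using hasSupport_one (Q := Q)

theorem hasSupport_prob_singleton (a : A) : HasSupport (𝒜.prob [a]) (𝒜.letter a) := by
  intro s t
  simp [prob, letter]

theorem consistent_markovMonoid : 𝒜.Consistent 𝒜.markovMonoid := by
  intro u hu
  induction hu with
  | one => exact ⟨_, reifies_const hasSupport_prob_nil⟩
  | letter a => exact ⟨_, reifies_const (hasSupport_prob_singleton a)⟩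
  | mul _ _ ih ih' =>
    obtain ⟨w, hw⟩ := ih
    obtain ⟨w', hw'⟩ := ih'
    exact ⟨_, hw.mul hw'⟩
  | iter hu _ ih =>
    obtain ⟨w, hw⟩ := ih
    obtain ⟨φ, k, h⟩ := hw.iter hu
    exact ⟨_, h⟩

variable (𝒜) in
/-- The limit-word `u` belongs to the Markov monoid and is reified by words with support `v`. -/
def Realizes (v u : LimitWord Q) : Prop :=
  𝒜.InMarkovMonoid u ∧ ∃ w, 𝒜.Reifies w u ∧ ∀ n, HasSupport (𝒜.prob (w n)) v

theorem Realizes.mul {v u v' u' : LimitWord Q} (h : 𝒜.Realizes v u) (h' : 𝒜.Realizes v' u') :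
    𝒜.Realizes (v * v') (u * u') := by
  obtain ⟨hu, w, hw, hv⟩ := h
  obtain ⟨hu', w', hw', hv'⟩ := h'
  refine ⟨hu.mul hu', _, hw.mul hw', fun n => ?_⟩
  rw [prob_append]
  exact (hv n).mul (𝒜.prob_mem _) (𝒜.prob_mem _) (hv' n)

theorem Realizes.iter {v u : LimitWord Q} (hv : v * v = v) (hu : u * u = u)
    (h : 𝒜.Realizes v u) : 𝒜.Realizes v (u.iter hu) := by
  obtain ⟨hmem, w, hw, hwv⟩ := h
  obtain ⟨φ, k, hφ⟩ := hw.iter hu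
  refine ⟨hmem.iter hu, _, hφ, fun n => ?_⟩
  rw [prob_replicate_flatten, ← List.prod_replicate]
  refine HasSupport.list_prod hv _ (by simp) fun m hm => ?_
  rw [List.eq_of_mem_replicate hm]
  exact ⟨𝒜.prob_mem _, hwv _⟩

/-- Were the edge back missing, the reifying words would form a leak: they are idempotent because
`v` is, and as `u` is idempotent, reachability in the limit chain is equality or a single `u`-edge.
-/
theorem Leaktight.edge_of_recurrent (h𝒜 : 𝒜.Leaktight) {v u : LimitWord Q} (hv : v * v = v)
    (hu : u * u = u) (h : 𝒜.Realizes v u) {r q : Q} (hr : u.Recurrent r) (hrq : v.edge r q) :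
    u.edge q r := by
  obtain ⟨-, w, hw, hwv⟩ := h
  by_contra hqr
  choose P hP hPu using hw
  have hreach : ∀ s t, ChainReachable P s t → s = t ∨ u.edge s t := by
    intro s t hst
    induction hst with
    | refl => exact Or.inl rfl
    | tail _ h ih =>
      rcases ih with rfl | ih
      · exact Or.inr ((hPu _ _).2 h)
      · exact Or.inr (LimitWord.edge_trans hu ih ((hPu _ _).2 h))
  refine h𝒜 ⟨w, r, q, fun n s t => ?_, P, hP, fun t ht => ?_, fun n => (hwv n r q).1 hrq, ?_⟩
  · rw [prob_append, ← hwv n s t]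
    conv_lhs => rw [← hv]
    exact (hwv n).mul (𝒜.prob_mem _) (𝒜.prob_mem _) (hwv n) s t
  · rcases hreach r t ht with rfl | ht
    · exact .refl
    · exact .single ((hPu _ _).1 (hr t ht))
  · intro hcon
    rcases hreach q r hcon with rfl | hcon
    · exact hqr (hr.edge_self hu)
    · exact hqr hcon

variable (𝒜) in
/-- A matrix with its support and a realizable limit-word all of whose edges carry entries of the
matrix that are at least `p ^ 2 ^ k`. -/
def LowerBound (p : ℝ) (k : ℕ) (z : (LimitWord Q × LimitWord Q) × Matrix Q Q ℝ) : Prop :=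
  𝒜.Realizes z.1.1 z.1.2 ∧ z.2 ∈ rowStochastic ℝ Q ∧ HasSupport z.2 z.1.1 ∧
    ∀ s t, z.1.2.edge s t → p ^ 2 ^ k ≤ z.2 s t

/-- Each level squares the bound, whence `p ^ 2 ^ k`. Leaktightness enters only at iteration nodes,
where it keeps the cost independent of the number of factors. -/
theorem Leaktight.isTreeFiltration (h𝒜 : 𝒜.Leaktight) {p : ℝ} (hp : 0 < p) (hp1 : p ≤ 1) :
    IsTreeFiltration (fun x : LimitWord Q × LimitWord Q => (x.1, x.2.sharp)) (𝒜.LowerBound p) where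
  one := by
    refine ⟨⟨.one, _, reifies_const hasSupport_prob_nil, fun _ => hasSupport_prob_nil⟩,
      one_mem _, hasSupport_one, fun s t hst => ?_⟩
    cases (show s = t from hst)
    simpa using hp1
  succ k z hz := ⟨hz.1, hz.2.1, hz.2.2.1, fun s t hst =>
    (pow_le_pow_of_le_one hp.le hp1 (Nat.pow_le_pow_right (by omega) (by omega))).trans
      (hz.2.2.2 s t hst)⟩
  mul k z z' hz hz' := by
    refine ⟨hz.1.mul hz'.1, mul_mem hz.2.1 hz'.2.1, hz.2.2.1.mul hz.2.1 hz'.2.1 hz'.2.2.1, ?_⟩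
    rintro s t ⟨q, hq, hq'⟩
    rw [pow_succ, mul_two, pow_add]
    exact (mul_le_mul (hz.2.2.2 s q hq) (hz'.2.2.2 q t hq') (by positivity)
      (nonneg_of_rowStochastic hz.2.1 s q)).trans
      (mul_apply_le_of_rowStochastic hz.2.1 hz'.2.1 s q t)
  iter k e l he hl h := by
    have hv : e.1 * e.1 = e.1 := congrArg Prod.fst he
    have hu : e.2 * e.2 = e.2 := congrArg Prod.snd he
    have hsnd : l.prod.2 = (l.map Prod.snd).prod := by
      simpa using map_list_prod (MonoidHom.snd (LimitWord Q × LimitWord Q) (Matrix Q Q ℝ)) l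
    have hl' : l.map Prod.snd ≠ [] := by simpa using hl
    have hmem : ∀ m ∈ l.map Prod.snd, m ∈ rowStochastic ℝ Q ∧ HasSupport m e.1 ∧
        ∀ s t, e.2.edge s t → p ^ 2 ^ k ≤ m s t := by
      intro m hm
      obtain ⟨z, hz, rfl⟩ := List.mem_map.1 hm
      obtain ⟨hze, -, h1, h2, h3⟩ := h z hz
      rw [hze] at h2 h3
      exact ⟨h1, h2, h3⟩
    have hreal : 𝒜.Realizes e.1 e.2 := by
      obtain ⟨z, hz⟩ := List.exists_mem_of_ne_nil l hl
      obtain ⟨hze, hz, -⟩ := h z hz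
      rwa [hze] at hz
    change 𝒜.Realizes e.1 e.2.sharp ∧ l.prod.2 ∈ rowStochastic ℝ Q ∧ HasSupport l.prod.2 e.1 ∧
      ∀ s t, e.2.sharp.edge s t → p ^ 2 ^ (k + 1) ≤ l.prod.2 s t
    rw [hsnd, LimitWord.sharp_of_idem hu]
    refine ⟨hreal.iter hv hu, Submonoid.list_prod_mem _ fun m hm => (hmem m hm).1,
      HasSupport.list_prod hv _ hl' fun m hm => ⟨(hmem m hm).1, (hmem m hm).2.1⟩, fun s t hst => ?_⟩
    rw [pow_succ, pow_mul]
    exact sq_le_list_prod hu hv (fun r q => h𝒜.edge_of_recurrent hv hu hreal) (by positivity)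
      (pow_le_one₀ hp.le hp1) _ hl' hmem hst

variable (𝒜) in
theorem exists_le_trans [Finite A] :
    ∃ p : ℝ, 0 < p ∧ p ≤ 1 ∧ ∀ a s t, (𝒜.letter a).edge s t → p ≤ 𝒜.trans a s t := by
  choose δ h0 h1 hδ using fun a => exists_le_of_hasSupport (m := 𝒜.trans a) (u := 𝒜.letter a)
    fun _ _ => Iff.rfl
  obtain ⟨p, hp, hpδ⟩ := exists_pos_forall_le_of_finite h0
  exact ⟨min p 1, lt_min hp one_pos, min_le_right _ _, fun a s t hst =>
    (min_le_left _ _).trans ((hpδ a).trans (hδ a s t hst))⟩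

theorem Leaktight.complete_markovMonoid [Finite A] (h𝒜 : 𝒜.Leaktight) :
    𝒜.Complete 𝒜.markovMonoid := by
  obtain ⟨p, hp, hp1, hpa⟩ := 𝒜.exists_le_trans
  obtain ⟨K, hK⟩ := IsTreeFiltration.exists_bound LimitWord.isIteration_prod_sharp
    (h𝒜.isTreeFiltration hp hp1) (X := Set.range 𝒜.trans) (by
      rintro _ ⟨a, rfl⟩
      refine ⟨(𝒜.letter a, 𝒜.letter a), ⟨.letter a, _, reifies_const (hasSupport_prob_singleton a),
        fun _ => hasSupport_prob_singleton a⟩, 𝒜.trans_stochastic a, fun _ _ => Iff.rfl, ?_⟩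
      simpa using hpa a)
  intro w
  choose x hx using fun n => hK ((w n).map 𝒜.trans) (by simp)
  -- A label used infinitely often suffices: the uniform bound then holds for infinitely many `n`,
  -- which keeps the limit superior positive on every edge of `y.2`.
  obtain ⟨y, hy⟩ := Finite.exists_infinite_fiber x
  have hinf : (x ⁻¹' {y}).Infinite := Set.infinite_coe_iff.1 hy
  obtain ⟨n₀, hn₀⟩ := hinf.nonempty
  refine ⟨y.2, ?_, fun s t hlim hst => ?_⟩
  · have := (hx n₀).1.1
    rwa [show x n₀ = y from hn₀] at this
  · have hfreq : ∃ᶠ n in atTop, p ^ 2 ^ K ≤ 𝒜.prob (w n) s t := by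
      refine (Nat.frequently_atTop_iff_infinite.2 hinf).mono fun n hn => ?_
      refine (hx n).2.2.2 s t ?_
      rw [show x n = y from hn]
      exact hst
    have hle := le_limsup_of_frequently_le hfreq
      (isBoundedUnder_of ⟨1, fun n => le_one_of_mem_rowStochastic (𝒜.prob_mem _) s t⟩)
    have : 0 < p ^ 2 ^ K := by positivity
    linarith

end ProbAutomaton

theorem mainTheorem2 {Q A : Type*} [Fintype Q] [DecidableEq Q] [Finite A]
    (𝒜 : ProbAutomaton Q A) :
    𝒜.Consistent 𝒜.markovMonoid ∧ (𝒜.Leaktight → 𝒜.Complete 𝒜.markovMonoid) :=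
  ⟨ProbAutomaton.consistent_markovMonoid, fun h => h.complete_markovMonoid⟩
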